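/- A $\mathbb{T}$-gain graph $\Phi=(G,\varphi)$ consists of a finite simple graph $G$ (its underlying graph) and a map $\varphi$ assigning to each oriented edge $\overrightarrow{uv}$ of $G$ a complex number $\varphi(uv)$ with $|\varphi(uv)|=1$ such that $\varphi(vu)=\varphi(uv)^{-1}$. Its adjacency matrix $A(\Phi)$ has entry $\varphi(uv)$ in position $(u,v)$ if $u$ and $v$ are adjacent and $0$ otherwise; $r(\Phi)$ is the rank of $A(\Phi)$, and $r(G)$ is the rank of the usual $0$-$1$ adjacency matrix of $G$. Let $\theta(G)=|E(G)|-|V(G)|+\omega(G)$, where $\omega(G)$ is the number of connected components of $G$. A cycle $v_1v_2\cdots v_nv_1$ of $\Phi$ is of Type B if $n$ is even and $\varphi(v_1v_2)\varphi(v_2v_3)\cdots\varphi(v_{n-1}v_n)\varphi(v_nv_1)\neq(-1)^{n/2}$. Theorem. Let $\Phi=(G,\varphi)$ be a $\mathbb{T}$-gain graph whose underlying graph $G$ has at least one edge. Then $r(G)\neq 0$ and $$1-\theta(G)\le\frac{r(\Phi)}{r(G)}\le 1+\theta(G).$$ (a) Equality holds in the upper bound if and only if $G$ is acyclic, or $\Phi$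 consists of a $4$-cycle of Type B together with some (possibly no) isolated vertices. (b) Equality holds in the lower bound if and only if $G$ is acyclic. -/

import Mathlib

/-- A complex unit gain graph (`𝕋`-gain graph) with vertex type `V`: a simple underlying graph
together with a gain of modulus one for each oriented edge, such that reversing an oriented edge
inverts its gain. -/
structure TGainGraph (V : Type*) where
  graph : SimpleGraph V
  gain : graph.Dart → Circle
  gain_symm : ∀ d : graph.Dart, gain d.symm = (gain d)⁻¹

namespace SimpleGraph

/-- The dimension `θ(G) = |E(G)| - |V(G)| + ω(G)` of the cycle space of `G`, where `ω(G)` is the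
number of connected components. It is an integer, so the subtraction does not truncate. -/
noncomputable def cycleDim {V : Type*} (G : SimpleGraph V) : ℤ :=
  (Nat.card G.edgeSet : ℤ) - (Nat.card V : ℤ) + (Nat.card G.ConnectedComponent : ℤ)

open Classical in
/-- The rank `r(G)` of a graph: the rank of its `0`-`1` adjacency matrix. -/
noncomputable def adjRank {V : Type*} [Fintype V] (G : SimpleGraph V) : ℕ :=
  (G.adjMatrix ℝ).rank

end SimpleGraph

namespace TGainGraph

open Classical in
/-- The adjacency matrix `A(Φ)`: the `(i, j)` entry is the gain of the oriented edge from `i` to `j`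
if `i` and `j` are adjacent, and `0` otherwise. -/
noncomputable def adjMatrix {V : Type*} (Φ : TGainGraph V) : Matrix V V ℂ :=
  Matrix.of fun i j => if h : Φ.graph.Adj i j then (Φ.gain ⟨(i, j), h⟩ : ℂ) else 0

/-- The rank `r(Φ)` of a `𝕋`-gain graph. -/
noncomputable def rank {V : Type*} [Fintype V] (Φ : TGainGraph V) : ℕ :=
  Φ.adjMatrix.rank

/-- The gain of a walk: the product of the gains of its oriented edges. -/
noncomputable def walkGain {V : Type*} (Φ : TGainGraph V) {u v : V} (w : Φ.graph.Walk u v) :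
    Circle :=
  (w.darts.map Φ.gain).prod

/-- A cycle of order `n`, traversed from some base vertex in some direction, is of Type B if `n` is
even and its gain differs from `(-1) ^ (n / 2)`. This depends neither on the base vertex nor on the
direction: moving the base vertex does not change the gain, and reversing the direction inverts it,
while `(-1) ^ (n / 2)` is its own inverse. -/
def IsTypeB {V : Type*} (Φ : TGainGraph V) {v : V} (c : Φ.graph.Walk v v) : Prop :=
  c.IsCycle ∧ Even c.length ∧ (Φ.walkGain c : ℂ) ≠ (-1) ^ (c.length / 2)

/-- `Φ` consists of a `4`-cycle of Type B and some (possibly no) isolated vertices: there is such a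
cycle, and every edge of the underlying graph is an edge of it, so that every vertex off the cycle
is isolated. -/
def IsTypeBFourCycleWithIsolated {V : Type*} (Φ : TGainGraph V) : Prop :=
  ∃ (v : V) (c : Φ.graph.Walk v v),
    c.length = 4 ∧ Φ.IsTypeB c ∧ ∀ e ∈ Φ.graph.edgeSet, e ∈ c.edges

end TGainGraph

/-! Everything rests on $|r(\Phi)-r(G)|\le 2\theta$ with $\theta=\theta(G)$. On a spanning forest
the gains are differences of a potential, so conjugating by a unitary diagonal matrix makes them all
$1$ without changing the rank (`exists_switching`). The result differs from $A(G)$ only at the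
$\theta$ edges off the forest; these are covered by $\theta$ vertices, hence by $\theta$ rows and
$\theta$ columns. Since $r(G)\ge 2$, the upper bound follows on division. For $\theta\ge1$ the lower
bound is strict, because $1-\theta\le 0<r(\Phi)/r(G)$.

Equality above with $\theta\ge1$ forces $r(G)=2$ and $r(\Phi)=2+2\theta$. A graph of rank two is
some $K_{s,t}$ plus isolated vertices (`adj_iff_of_adjRank_le_two`), so $\theta\ge(s-1)(t-1)$, while
a vertex cover gives $r(\Phi)\le2\min(s,t)$. Hence $s=t=2$, and a 4-cycle has $r(\Phi)=4$ exactly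
when its gain is not $1$. -/

namespace Matrix

/-! ### Ranks of matrices over a field -/

variable {m n K L : Type*}

theorem rank_add_le [Finite m] [Fintype n] [Field K] (A B : Matrix m n K) :
    (A + B).rank ≤ A.rank + B.rank := by
  rw [rank, rank, rank, mulVecLin_add]
  exact (Submodule.finrank_mono (LinearMap.range_add_le _ _)).trans
    (Submodule.finrank_add_le_finrank_add_finrank _ _)

/-- A matrix all of whose nonzero entries lie in a row or a column indexed by `S` has rank at most
`2 * #S`. -/
theorem rank_le_two_mul_card_of_cover [Fintype m] [Field K] (A : Matrix m m K) (S : Finset m)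
    (h : ∀ i j, A i j ≠ 0 → i ∈ S ∨ j ∈ S) : A.rank ≤ 2 * S.card := by
  classical
  let R : Matrix m m K := of fun i j => if i ∈ S then A i j else 0
  let C : Matrix m m K := of fun i j => if i ∈ S then 0 else A i j
  have hA : A = R + C := by
    ext i j
    by_cases hi : i ∈ S <;> simp [R, C, hi]
  have hR : R.rank ≤ S.card := by
    refine R.rank_le_card_of_support_subset S fun i hi => ?_
    by_contra hS
    refine hi (funext fun j => ?_)
    simp only [Finset.mem_coe] at hS
    simp [R, Matrix.row, hS]
  have hC : C.rank ≤ S.card := by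
    rw [← rank_transpose]
    refine Cᵀ.rank_le_card_of_support_subset S fun j hj => ?_
    by_contra hS
    refine hj (funext fun i => ?_)
    simp only [Finset.mem_coe] at hS
    by_cases hi : i ∈ S
    · simp [C, Matrix.row, hi]
    · by_contra h0
      rcases h i j (by simpa [C, Matrix.row, hi] using h0) with h1 | h1
      · exact hi h1
      · exact hS h1
  rw [hA]
  have := rank_add_le R C
  omega

theorem rank_fromBlocks_one_zero [Field K] (r s : ℕ) :
    (fromBlocks 1 0 0 0 : Matrix (Fin r ⊕ Fin s) (Fin r ⊕ Fin s) K).rank = r := by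
  classical
  rw [← diagonal_one, ← diagonal_zero, fromBlocks_diagonal, rank_diagonal, Fintype.card_subtype]
  have : (Finset.univ.filter fun i : Fin r ⊕ Fin s =>
      Sum.elim (fun _ => (1 : K)) (fun _ => 0) i ≠ 0) =
      Finset.univ.map Function.Embedding.inl := by
    ext i
    rcases i with i | i <;> simp
  rw [this, Finset.card_map, Finset.card_univ, Fintype.card_fin]

/-- A ring homomorphism of fields keeps invertible matrices invertible and fixes the normal form
`fromBlocks 1 0 0 0`. This carries the real rank of a graph over to $\mathbb{C}$. -/
theorem rank_map_field [Fintype m] [Field K] [Field L] (f : K →+* L) (A : Matrix m m K) :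
    (A.map f).rank = A.rank := by
  classical
  obtain ⟨V, U, e, hV, hU, h⟩ := A.exists_rank_normal_form
  have hV' : IsUnit (V.map f).det := by
    rw [← RingHom.mapMatrix_apply, ← RingHom.map_det]
    exact ((isUnit_iff_isUnit_det _).1 hV).map f
  have hU' : IsUnit (U.map f).det := by
    rw [← RingHom.mapMatrix_apply, ← RingHom.map_det]
    exact ((isUnit_iff_isUnit_det _).1 hU).map f
  have h' := congrArg (fun M => (M.map f).rank) h
  simp only [Matrix.map_mul, rank_mul_eq_left_of_isUnit_det _ _ hU',
    rank_mul_eq_right_of_isUnit_det _ _ hV'] at h'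
  rw [h', ← submatrix_map, rank_submatrix, fromBlocks_map,
    Matrix.map_one f (map_zero f) (map_one f), Matrix.map_zero f (map_zero f),
    Matrix.map_zero f (map_zero f), Matrix.map_zero f (map_zero f), rank_fromBlocks_one_zero]

theorem card_le_rank_of_det_submatrix_ne_zero [Fintype m] [Field K] {k : ℕ} (A : Matrix m m K)
    (r c : Fin k → m) (h : (A.submatrix r c).det ≠ 0) : k ≤ A.rank := by
  have := A.rank_submatrix_le r c
  rwa [rank_of_det_ne_zero h, Fintype.card_fin] at this

section FourCycle

variable [Field K] {A : Matrix m m K} {a b c d : m}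

/-- A matrix supported on the 4-cycle `a b c d` whose two nonzero blocks are singular has rank at
most two. -/
theorem rank_le_two_of_fourCycle [Fintype m]
    (hA : ∀ i j, A i j ≠ 0 → (i = a ∨ i = c) ∧ (j = b ∨ j = d) ∨ (i = b ∨ i = d) ∧ (j = a ∨ j = c))
    (hab : A a b ≠ 0) (hba : A b a ≠ 0)
    (h₁ : A a b * A c d = A a d * A c b) (h₂ : A b a * A d c = A b c * A d a)
    (hac : a ≠ b ∧ a ≠ d ∧ c ≠ b ∧ c ≠ d) : A.rank ≤ 2 := by
  classical
  obtain ⟨n1, n2, n3, n4⟩ := hac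
  have hz : ∀ i j, ¬ ((i = a ∨ i = c) ∧ (j = b ∨ j = d) ∨ (i = b ∨ i = d) ∧ (j = a ∨ j = c)) →
      A i j = 0 := fun i j h => by
    by_contra h0
    exact h (hA i j h0)
  have hc : A.row c = (A c b / A a b) • A.row a := by
    ext j
    by_cases hb : j = b
    · subst hb; simp [Matrix.row, hab]
    by_cases hd : j = d
    · subst hd
      simp only [Matrix.row, Pi.smul_apply, smul_eq_mul]
      field_simp
      linear_combination h₁
    · simp only [Matrix.row, Pi.smul_apply, smul_eq_mul]
      rw [hz c j (by tauto), hz a j (by tauto), mul_zero]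
  have hd : A.row d = (A d a / A b a) • A.row b := by
    ext j
    by_cases ha : j = a
    · subst ha; simp [Matrix.row, hba]
    by_cases hc : j = c
    · subst hc
      simp only [Matrix.row, Pi.smul_apply, smul_eq_mul]
      field_simp
      linear_combination h₂
    · simp only [Matrix.row, Pi.smul_apply, smul_eq_mul]
      rw [hz d j (by tauto), hz b j (by tauto), mul_zero]
  rw [rank_eq_finrank_span_row]
  have hle : Submodule.span K (Set.range A.row) ≤
      Submodule.span K (({A.row a, A.row b} : Finset (m → K)) : Set (m → K)) := by
    rw [Submodule.span_le]
    rintro _ ⟨i, rfl⟩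
    have ha' : A.row a ∈ Submodule.span K (({A.row a, A.row b} : Finset (m → K)) : Set (m → K)) :=
      Submodule.subset_span (by simp)
    have hb' : A.row b ∈ Submodule.span K (({A.row a, A.row b} : Finset (m → K)) : Set (m → K)) :=
      Submodule.subset_span (by simp)
    by_cases h1 : i = a
    · exact h1 ▸ ha'
    by_cases h2 : i = b
    · exact h2 ▸ hb'
    by_cases h3 : i = c
    · rw [h3, hc]; exact Submodule.smul_mem _ _ ha'
    by_cases h4 : i = d
    · rw [h4, hd]; exact Submodule.smul_mem _ _ hb'
    · have : A.row i = 0 := funext fun j => hz i j (by tauto)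
      rw [this]; exact Submodule.zero_mem _
  exact (Submodule.finrank_mono hle).trans
    ((finrank_span_finset_le_card _).trans Finset.card_le_two)

/-- A matrix supported on the 4-cycle `a b c d` whose two nonzero blocks are regular has rank at
least four. -/
theorem four_le_rank_of_fourCycle [Fintype m]
    (hA : ∀ i j, A i j ≠ 0 → (i = a ∨ i = c) ∧ (j = b ∨ j = d) ∨ (i = b ∨ i = d) ∧ (j = a ∨ j = c))
    (h₁ : A a b * A c d ≠ A a d * A c b) (h₂ : A b a * A d c ≠ A b c * A d a)
    (hac : a ≠ b ∧ a ≠ d ∧ c ≠ b ∧ c ≠ d) : 4 ≤ A.rank := by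
  obtain ⟨n1, n2, n3, n4⟩ := hac
  have hz : ∀ i j, ¬ ((i = a ∨ i = c) ∧ (j = b ∨ j = d) ∨ (i = b ∨ i = d) ∧ (j = a ∨ j = c)) →
      A i j = 0 := fun i j h => by
    by_contra h0
    exact h (hA i j h0)
  -- Listing the parts $\{a,c\}$ and $\{b,d\}$ in opposite orders for rows and columns makes the
  -- submatrix block diagonal.
  refine A.card_le_rank_of_det_submatrix_ne_zero ![a, c, b, d] ![b, d, a, c] ?_
  have hM : A.submatrix ![a, c, b, d] ![b, d, a, c] = !![A a b, A a d, 0, 0; A c b, A c d, 0, 0;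
      0, 0, A b a, A b c; 0, 0, A d a, A d c] := by
    ext i j
    fin_cases i <;> fin_cases j <;> first | rfl | exact hz _ _ (by simp; tauto)
  have : (A.submatrix ![a, c, b, d] ![b, d, a, c]).det =
      (A a b * A c d - A a d * A c b) * (A b a * A d c - A b c * A d a) := by
    rw [hM]
    simp [det_succ_row_zero, Fin.sum_univ_succ, Fin.succAbove]
    ring
  rw [this]
  exact mul_ne_zero (sub_ne_zero.2 h₁) (sub_ne_zero.2 h₂)

end FourCycle

end Matrix

/-! ### Spanning forests and the cycle space -/

namespace SimpleGraph

variable {V : Type*} {G F : SimpleGraph V}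

/-- The edges of a graph are the edges of its connected components. -/
theorem card_edgeSet_eq_sum_connectedComponent [Finite V] [Fintype G.ConnectedComponent] :
    Nat.card G.edgeSet = ∑ c : G.ConnectedComponent, Nat.card c.toSimpleGraph.edgeSet := by
  rw [← Nat.card_sigma]
  symm
  refine Nat.card_eq_of_bijective
    (fun x => (⟨Sym2.map (↑) x.2.1, ?_⟩ : G.edgeSet)) ⟨?_, ?_⟩
  · obtain ⟨c, e, he⟩ := x
    induction e with
    | _ u v => exact he
  · rintro ⟨c, e, he⟩ ⟨c', e', he'⟩ h
    simp only [Subtype.mk.injEq] at h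
    induction e with
    | _ u v =>
    induction e' with
    | _ u' v' =>
    obtain ⟨u, hu⟩ := u
    obtain ⟨v, hv⟩ := v
    obtain ⟨u', hu'⟩ := u'
    obtain ⟨v', hv'⟩ := v'
    have hc : c = c' := by
      change G.connectedComponentMk u = c at hu
      change G.connectedComponentMk u' = c' at hu'
      change G.connectedComponentMk v' = c' at hv'
      simp only [Sym2.map_mk, Sym2.eq_iff] at h
      grind
    subst hc
    have := Sym2.map.injective Subtype.val_injective h
    simp [this]
  · rintro ⟨e, he⟩
    induction e with
    | _ u v =>
    have huv : G.Adj u v := he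
    refine ⟨⟨G.connectedComponentMk u, s(⟨u, rfl⟩, ⟨v, ?_⟩), ?_⟩, ?_⟩
    · exact ConnectedComponent.sound huv.symm.reachable
    · exact huv
    · rfl

theorem IsAcyclic.card_edgeSet_add_card_connectedComponent [Finite V] (h : G.IsAcyclic) :
    Nat.card G.edgeSet + Nat.card G.ConnectedComponent = Nat.card V := by
  classical
  have := Fintype.ofFinite V
  have := Fintype.ofFinite G.ConnectedComponent
  have hV : Nat.card V = ∑ c : G.ConnectedComponent, Nat.card c := by
    rw [← Nat.card_sigma]
    refine (Nat.card_congr (Equiv.sigmaFiberEquiv G.connectedComponentMk)).symm.trans ?_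
    rfl
  rw [hV, card_edgeSet_eq_sum_connectedComponent, Nat.card_eq_fintype_card (α := G.ConnectedComponent),
    ← Finset.card_univ, Finset.card_eq_sum_ones, ← Finset.sum_add_distrib]
  exact Finset.sum_congr rfl fun c _ =>
    (isTree_iff_connected_and_card.1 (h.isTree_connectedComponent c)).2

/-- Group-valued weights on the oriented edges of a forest that are inverted by reversal are
differences of a potential. -/
theorem IsAcyclic.exists_potential {K : Type*} [Group K] (h : F.IsAcyclic) (g : V → V → K)
    (hg : ∀ u v, F.Adj u v → g v u = (g u v)⁻¹) :
    ∃ ψ : V → K, ∀ u v, F.Adj u v → ψ v = ψ u * g u v := by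
  classical
  -- The potential at `v` is the weight of the path to `v` from a chosen root of its component.
  have hpath : ∀ v, ∃ p : F.Walk (F.connectedComponentMk v).out v, p.IsPath := fun v => by
    obtain ⟨p⟩ : F.Reachable (F.connectedComponentMk v).out v :=
      ConnectedComponent.exact (Quot.out_eq _)
    exact ⟨p.bypass, p.bypass_isPath⟩
  choose p hp using hpath
  let w : ∀ {a b : V}, F.Walk a b → K := fun q => (q.darts.map fun d => g d.fst d.snd).prod
  refine ⟨fun v => w (p v), fun u v huv => ?_⟩
  have key : ∀ (a : V) (q : F.Walk a u) (q' : F.Walk a v), q.IsPath → q'.IsPath →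
      w q' = w q * g u v := by
    intro a q q' hq hq'
    -- In a forest, of the paths from a root to two adjacent vertices, one extends the other by
    -- their edge.
    by_cases hu : u ∈ q'.support
    · rw [h.path_concat hq hq' huv hu]
      simp [w, Walk.darts_concat]
    · have hv := h.mem_support_of_ne_mem_support_of_adj_of_isPath hq hq' huv hu
      rw [h.path_concat hq' hq huv.symm hv]
      simp [w, Walk.darts_concat, hg u v huv]
  have hc : (F.connectedComponentMk v).out = (F.connectedComponentMk u).out :=
    congrArg Quot.out (ConnectedComponent.sound huv.symm.reachable)
  have h2 := key _ (p u) ((p v).copy hc rfl) (hp u) (by simpa using hp v)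
  rw [← h2]
  simp [w]

theorem Reachable.eq_of_isolated {z w : V} (h : G.Reachable z w) (hz : ∀ x, ¬ G.Adj z x) :
    z = w := by
  obtain ⟨p⟩ := h
  cases p with
  | nil => rfl
  | cons h _ => exact absurd h (hz _)

theorem exists_forest_cycleDim [Finite V] (G : SimpleGraph V) :
    ∃ F ≤ G, F.IsAcyclic ∧ G.cycleDim = ((G.edgeSet \ F.edgeSet).ncard : ℤ) := by
  obtain ⟨F, hF, hacyc, hr⟩ := G.exists_isAcyclic_reachable_eq_le
  refine ⟨F, hF, hacyc, ?_⟩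
  have h1 := hacyc.card_edgeSet_add_card_connectedComponent
  have h2 : Nat.card F.ConnectedComponent = Nat.card G.ConnectedComponent := by
    unfold ConnectedComponent
    rw [hr]
  have h3 := Set.ncard_sdiff_add_ncard_of_subset (edgeSet_mono hF) (Set.toFinite _)
  rw [← Nat.card_coe_set_eq F.edgeSet, ← Nat.card_coe_set_eq G.edgeSet] at h3
  unfold cycleDim
  omega

theorem cycleDim_nonneg [Finite V] (G : SimpleGraph V) : 0 ≤ G.cycleDim := by
  obtain ⟨F, -, -, h⟩ := G.exists_forest_cycleDim
  omega

theorem cycleDim_eq_zero_iff [Finite V] : G.cycleDim = 0 ↔ G.IsAcyclic := by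
  constructor
  · intro h0
    obtain ⟨F, hF, hacyc, h⟩ := G.exists_forest_cycleDim
    have h1 : (G.edgeSet \ F.edgeSet).ncard = 0 := by omega
    rw [Set.ncard_eq_zero (Set.toFinite _), Set.sdiff_eq_empty, edgeSet_subset_edgeSet] at h1
    exact hacyc.anti h1
  · intro h
    have := h.card_edgeSet_add_card_connectedComponent
    unfold cycleDim
    omega

/-- A set of edges has a vertex cover with at most as many vertices as there are edges. -/
theorem exists_cover [Finite V] (E : Set (Sym2 V)) :
    ∃ S : Finset V, S.card ≤ E.ncard ∧ ∀ i j, s(i, j) ∈ E → i ∈ S ∨ j ∈ S := by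
  classical
  have hE := Set.toFinite E
  refine ⟨hE.toFinset.image fun e => (Quot.out e).1, ?_, fun i j hij => ?_⟩
  · rw [Set.ncard_eq_toFinset_card E hE]
    exact Finset.card_image_le
  · have hm : (Quot.out s(i, j)).1 ∈ (hE.toFinset.image fun e => (Quot.out e).1) :=
      Finset.mem_image_of_mem _ (hE.mem_toFinset.2 hij)
    rcases Sym2.mem_iff.1 (Sym2.out_fst_mem s(i, j)) with h | h
    · exact Or.inl (h ▸ hm)
    · exact Or.inr (h ▸ hm)

end SimpleGraph

/-! ### Adjacency matrices and graphs of rank two -/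

namespace TGainGraph

variable {V : Type*} (Φ : TGainGraph V)

theorem adjMatrix_of_adj {i j : V} (h : Φ.graph.Adj i j) :
    Φ.adjMatrix i j = (Φ.gain ⟨(i, j), h⟩ : ℂ) := by
  simp [adjMatrix, h]

theorem adjMatrix_ne_zero_iff {i j : V} : Φ.adjMatrix i j ≠ 0 ↔ Φ.graph.Adj i j := by
  by_cases h : Φ.graph.Adj i j
  · simp [adjMatrix, h]
  · simp [adjMatrix, h]

theorem adjMatrix_mul_adjMatrix_symm {i j : V} (h : Φ.graph.Adj i j) :
    Φ.adjMatrix i j * Φ.adjMatrix j i = 1 := by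
  have := Φ.gain_symm ⟨(i, j), h⟩
  rw [adjMatrix_of_adj _ h, adjMatrix_of_adj _ h.symm, ← Circle.coe_mul,
    show Φ.gain ⟨(j, i), h.symm⟩ = (Φ.gain ⟨(i, j), h⟩)⁻¹ from this, mul_inv_cancel, Circle.coe_one]

end TGainGraph

namespace SimpleGraph

variable {V : Type*}

open Classical in
theorem adjRank_eq_rank_complex [Fintype V] (G : SimpleGraph V) :
    G.adjRank = (G.adjMatrix ℂ).rank := by
  rw [adjRank, ← Matrix.rank_map_field Complex.ofRealHom]
  congr 1
  ext i j
  by_cases h : G.Adj i j <;> simp [h]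

theorem two_le_adjRank [Fintype V] {G : SimpleGraph V} (h : G ≠ ⊥) : 2 ≤ G.adjRank := by
  classical
  obtain ⟨u, v, huv⟩ := G.ne_bot_iff_exists_adj.1 h
  refine Matrix.card_le_rank_of_det_submatrix_ne_zero _ ![u, v] ![u, v] ?_
  rw [Matrix.det_fin_two]
  simp [huv, huv.symm]

/-- A graph whose rank is two is complete bipartite, up to isolated vertices. -/
theorem adj_iff_of_adjRank_le_two [Fintype V] {G : SimpleGraph V} (h : G.adjRank ≤ 2) {u v : V}
    (huv : G.Adj u v) (x y : V) :
    G.Adj x y ↔ G.Adj v y ∧ G.Adj u x ∨ G.Adj u y ∧ G.Adj v x := by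
  classical
  -- Expanded, this minor says $a_{xy}=a_{vy}a_{ux}+a_{uy}a_{vx}$. On the diagonal it shows that `u`
  -- and `v` have no common neighbour, so the two terms are never both $1$.
  have hdet : ∀ x y, ((G.adjMatrix ℝ).submatrix ![u, v, x] ![u, v, y]).det = 0 := by
    intro x y
    by_contra hne
    have h3 := Matrix.card_le_rank_of_det_submatrix_ne_zero _ _ _ hne
    have h4 : (G.adjMatrix ℝ).rank ≤ 2 := by
      rw [adjRank] at h
      convert h
    omega
  have hx := hdet x y
  have hxx := hdet x x
  have hyy := hdet y y
  simp only [Matrix.det_fin_three, Matrix.submatrix_apply, adjMatrix_apply, Matrix.cons_val_zero,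
    Matrix.cons_val_one, Matrix.cons_val, huv, huv.symm, G.irrefl, if_true, if_false,
    G.adj_comm x u, G.adj_comm x v, G.adj_comm y u, G.adj_comm y v] at hx hxx hyy
  by_cases h1 : G.Adj u x <;> by_cases h2 : G.Adj v x <;> by_cases h3 : G.Adj u y <;>
    by_cases h4 : G.Adj v y <;> by_cases h5 : G.Adj x y <;>
    simp only [h1, h2, h3, h4, h5, if_true, if_false] at hx hxx hyy ⊢ <;>
    first | tauto | norm_num at hx

end SimpleGraph

/-! ### Switching and the two rank inequalities -/

namespace TGainGraph

variable {V : Type*} (Φ : TGainGraph V)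

open Classical in
/-- Every gain graph can be switched so that its adjacency matrix differs from that of the
underlying graph by a matrix of rank at most `2 * θ(G)`. -/
theorem exists_switching [Fintype V] : ∃ B : Matrix V V ℂ, B.rank = Φ.rank ∧
    ((B - Φ.graph.adjMatrix ℂ).rank : ℤ) ≤ 2 * Φ.graph.cycleDim := by
  obtain ⟨F, hF, hacyc, hdim⟩ := Φ.graph.exists_forest_cycleDim
  obtain ⟨ψ, hψ⟩ := hacyc.exists_potential
    (fun u v => if h : Φ.graph.Adj u v then Φ.gain ⟨(u, v), h⟩ else 1) (fun u v huv => by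
      simp only [hF huv, (hF huv).symm, dif_pos]
      exact Φ.gain_symm ⟨(u, v), hF huv⟩)
  let B : Matrix V V ℂ := Matrix.diagonal (fun i => (ψ i : ℂ)) * Φ.adjMatrix *
    Matrix.diagonal (fun i => ((ψ i)⁻¹ : Circle) : V → ℂ)
  have hB : ∀ i j, B i j = ψ i * Φ.adjMatrix i j * ((ψ j)⁻¹ : Circle) := fun i j => by
    simp [B, Matrix.mul_diagonal, Matrix.diagonal_mul]
  refine ⟨B, ?_, ?_⟩
  · have h1 : (Matrix.diagonal (fun i => ((ψ i)⁻¹ : Circle) : V → ℂ)).det ≠ 0 := by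
      rw [Matrix.det_diagonal]
      exact Finset.prod_ne_zero_iff.2 fun i _ => Circle.coe_ne_zero _
    have h2 : (Matrix.diagonal (fun i => (ψ i : ℂ))).det ≠ 0 := by
      rw [Matrix.det_diagonal]
      exact Finset.prod_ne_zero_iff.2 fun i _ => Circle.coe_ne_zero _
    rw [Matrix.rank_mul_eq_left_of_det_ne_zero _ _ h1, Matrix.rank_mul_eq_right_of_det_ne_zero _ _ h2,
      rank]
  · obtain ⟨S, hS, hcov⟩ := SimpleGraph.exists_cover (Φ.graph.edgeSet \ F.edgeSet)
    have := (B - Φ.graph.adjMatrix ℂ).rank_le_two_mul_card_of_cover S fun i j hij => by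
      refine hcov i j ⟨?_, fun hFij => hij ?_⟩
      · by_contra hadj
        rw [SimpleGraph.mem_edgeSet] at hadj
        refine hij ?_
        have := mt Φ.adjMatrix_ne_zero_iff.1 hadj
        rw [not_not] at this
        rw [Matrix.sub_apply, hB, this, SimpleGraph.adjMatrix_apply, if_neg hadj]
        simp
      · have h1 : F.Adj i j := hFij
        have h2 := hψ i j h1
        rw [dif_pos (hF h1)] at h2
        rw [Matrix.sub_apply, hB, SimpleGraph.adjMatrix_apply, if_pos (hF h1),
          Φ.adjMatrix_of_adj (hF h1), ← Circle.coe_mul, ← Circle.coe_mul, ← h2, mul_inv_cancel,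
          Circle.coe_one, sub_self]
    omega

theorem rank_le_adjRank_add [Fintype V] :
    (Φ.rank : ℤ) ≤ Φ.graph.adjRank + 2 * Φ.graph.cycleDim := by
  classical
  obtain ⟨B, hB, hD⟩ := Φ.exists_switching
  have := Matrix.rank_add_le (B - Φ.graph.adjMatrix ℂ) (Φ.graph.adjMatrix ℂ)
  rw [sub_add_cancel, hB, ← SimpleGraph.adjRank_eq_rank_complex] at this
  omega

theorem adjRank_le_rank_add [Fintype V] :
    (Φ.graph.adjRank : ℤ) ≤ Φ.rank + 2 * Φ.graph.cycleDim := by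
  classical
  obtain ⟨B, hB, hD⟩ := Φ.exists_switching
  have := Matrix.rank_add_le (-(B - Φ.graph.adjMatrix ℂ)) B
  have hneg : (-(B - Φ.graph.adjMatrix ℂ)).rank ≤ (B - Φ.graph.adjMatrix ℂ).rank := by
    rw [← neg_one_mul]
    exact Matrix.rank_mul_le_right _ _
  rw [neg_sub, sub_add_cancel, hB, ← SimpleGraph.adjRank_eq_rank_complex, ← neg_sub] at this
  omega

theorem one_le_rank [Fintype V] (h : Φ.graph ≠ ⊥) : 1 ≤ Φ.rank := by
  obtain ⟨u, v, huv⟩ := Φ.graph.ne_bot_iff_exists_adj.1 h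
  refine Matrix.card_le_rank_of_det_submatrix_ne_zero _ ![u] ![v] ?_
  rw [Matrix.det_fin_one]
  exact Φ.adjMatrix_ne_zero_iff.2 huv

end TGainGraph

/-! ### Complete bipartite graphs and 4-cycles -/

namespace SimpleGraph

variable {V : Type*} {G : SimpleGraph V} {a b c d : V}

/-- A complete bipartite subgraph meeting every edge gives a lower bound on the cycle space. -/
theorem mul_le_cycleDim_of_completeBipartite [Finite V] (S T : Finset V) (hS : S.Nonempty)
    (hST : Disjoint S T) (hadj : ∀ s ∈ S, ∀ t ∈ T, G.Adj s t)
    (hcov : ∀ x y, G.Adj x y → x ∈ S ∨ x ∈ T) :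
    ((S.card : ℤ) - 1) * ((T.card : ℤ) - 1) ≤ G.cycleDim := by
  classical
  have := Fintype.ofFinite V
  have hE : S.card * T.card ≤ Nat.card G.edgeSet := by
    have h := Nat.card_le_card_of_injective
      (fun p : S × T => (⟨s(p.1.1, p.2.1), hadj _ p.1.2 _ p.2.2⟩ : G.edgeSet)) (by
        rintro ⟨⟨s, hs⟩, ⟨t, ht⟩⟩ ⟨⟨s', hs'⟩, ⟨t', ht'⟩⟩ h
        rcases Sym2.eq_iff.1 (congrArg Subtype.val h) with ⟨rfl, rfl⟩ | ⟨rfl, rfl⟩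
        · rfl
        · exact absurd ht' (Finset.disjoint_left.1 hST hs))
    simpa using h
  -- Each vertex outside `S ∪ T` is a component by itself, and `s` lies in one more; `none` stands
  -- for the latter.
  have hω : Fintype.card V + 1 ≤ Nat.card G.ConnectedComponent + (S.card + T.card) := by
    obtain ⟨s, hs⟩ := hS
    have hiso : ∀ z ∈ (S ∪ T)ᶜ, ∀ x, ¬ G.Adj z x := by
      intro z hz x hzx
      simp only [Finset.mem_compl, Finset.mem_union] at hz
      exact hz (hcov z x hzx)
    have h := Nat.card_le_card_of_injective
      (fun o : Option ((S ∪ T)ᶜ : Finset V) =>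
        o.elim (G.connectedComponentMk s) fun z => G.connectedComponentMk z.1) (by
        rintro (_ | ⟨z, hz⟩) (_ | ⟨z', hz'⟩) h
        · rfl
        · have := (ConnectedComponent.exact h).symm.eq_of_isolated (hiso z' hz')
          subst this
          simp [hs] at hz'
        · have := (ConnectedComponent.exact h).eq_of_isolated (hiso z hz)
          subst this
          simp [hs] at hz
        · have := (ConnectedComponent.exact h).eq_of_isolated (hiso z hz)
          subst this
          rfl)
    rw [Finite.card_option, Nat.card_eq_fintype_card, Fintype.card_coe, Finset.card_compl,
      Finset.card_union_of_disjoint hST] at h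
    omega
  unfold cycleDim
  rw [Nat.card_eq_fintype_card (α := V)]
  have hE' : (S.card : ℤ) * T.card ≤ Nat.card G.edgeSet := by exact_mod_cast hE
  have hω' : (Fintype.card V : ℤ) + 1 ≤ Nat.card G.ConnectedComponent + (S.card + T.card) := by
    exact_mod_cast hω
  linarith

theorem Walk.isCycle_four (hab : G.Adj a b) (hbc : G.Adj b c) (hcd : G.Adj c d) (hda : G.Adj d a)
    (hac : a ≠ c) (hbd : b ≠ d) :
    (Walk.cons hab (.cons hbc (.cons hcd (.cons hda .nil)))).IsCycle := by
  have := hab.ne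
  have := hbc.ne
  have := hcd.ne
  have := hda.ne
  rw [Walk.cons_isCycle_iff]
  simp [Walk.cons_isPath_iff]
  grind

theorem cycleDim_le_one_of_fourCycle [Finite V] (hab : G.Adj a b) (hbc : G.Adj b c)
    (hcd : G.Adj c d) (hbd : b ≠ d)
    (hG : ∀ e ∈ G.edgeSet, e ∈ [s(a, b), s(b, c), s(c, d), s(d, a)]) (hac : a ≠ c)
    (hda : a ≠ d) : G.cycleDim ≤ 1 := by
  classical
  have := Fintype.ofFinite V
  have hE : Nat.card G.edgeSet ≤ 4 := by
    rw [Nat.card_coe_set_eq]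
    have hsub : G.edgeSet ⊆ ([s(a, b), s(b, c), s(c, d), s(d, a)].toFinset : Finset (Sym2 V)) :=
      fun e he => by simpa using hG e he
    refine (Set.ncard_le_ncard hsub (Finset.finite_toSet _)).trans ?_
    rw [Set.ncard_coe_finset]
    exact List.toFinset_card_le _
  -- The vertices other than `b`, `c`, `d` already meet every component, since those three are
  -- joined to `a`.
  have hω : Nat.card G.ConnectedComponent + 3 ≤ Fintype.card V := by
    have h := Nat.card_le_card_of_surjective
      (fun z : (({b, c, d} : Finset V)ᶜ : Finset V) => G.connectedComponentMk z.1) (by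
        intro C
        induction C using ConnectedComponent.ind with
        | _ w =>
        by_cases hw : w ∈ ({b, c, d} : Finset V)
        · refine ⟨⟨a, by simp [hab.ne, hac, hda]⟩, ConnectedComponent.sound ?_⟩
          simp only [Finset.mem_insert, Finset.mem_singleton] at hw
          rcases hw with rfl | rfl | rfl
          · exact hab.reachable
          · exact hab.reachable.trans hbc.reachable
          · exact (hab.reachable.trans hbc.reachable).trans hcd.reachable
        · exact ⟨⟨w, by simpa using hw⟩, rfl⟩)
    have h3 : ({b, c, d} : Finset V).card = 3 :=
      Finset.card_eq_three.2 ⟨b, c, d, hbc.ne, hbd, hcd.ne, rfl⟩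
    have h4 := Finset.card_le_univ ({b, c, d} : Finset V)
    rw [Nat.card_eq_fintype_card (α := (({b, c, d} : Finset V)ᶜ : Finset V)), Fintype.card_coe,
      Finset.card_compl, h3] at h
    omega
  unfold cycleDim
  rw [Nat.card_eq_fintype_card (α := V)]
  omega

/-- If every edge of `G` lies on the 4-cycle `a b c d`, then adjacent vertices lie in different
parts of its bipartition. -/
theorem Adj.mem_parts_of_fourCycle
    (hG : ∀ e ∈ G.edgeSet, e ∈ [s(a, b), s(b, c), s(c, d), s(d, a)]) {i j : V} (h : G.Adj i j) :
    (i = a ∨ i = c) ∧ (j = b ∨ j = d) ∨ (i = b ∨ i = d) ∧ (j = a ∨ j = c) := by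
  have := hG s(i, j) h
  simp only [List.mem_cons, Sym2.eq_iff, List.not_mem_nil, or_false] at this
  tauto

theorem adjRank_le_two_of_fourCycle [Fintype V] (hab : G.Adj a b) (hbc : G.Adj b c)
    (hcd : G.Adj c d) (hda : G.Adj d a)
    (hG : ∀ e ∈ G.edgeSet, e ∈ [s(a, b), s(b, c), s(c, d), s(d, a)]) : G.adjRank ≤ 2 := by
  classical
  refine Matrix.rank_le_two_of_fourCycle (a := a) (b := b) (c := c) (d := d) (fun i j hij => ?_)
    ?_ ?_ ?_ ?_ ⟨hab.ne, hda.ne', hbc.ne', hcd.ne⟩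
  · refine Adj.mem_parts_of_fourCycle hG (i := i) (j := j) ?_
    by_contra h
    simp [h] at hij
  all_goals simp [hab, hbc, hcd, hda, hab.symm, hbc.symm, hcd.symm, hda.symm]

end SimpleGraph

/-! ### The case of equality -/

namespace TGainGraph

open SimpleGraph

variable {V : Type*} (Φ : TGainGraph V) {a b c d : V}

theorem coe_walkGain_four (hab : Φ.graph.Adj a b) (hbc : Φ.graph.Adj b c) (hcd : Φ.graph.Adj c d)
    (hda : Φ.graph.Adj d a) :
    (Φ.walkGain (Walk.cons hab (.cons hbc (.cons hcd (.cons hda .nil)))) : ℂ) =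
      Φ.adjMatrix a b * Φ.adjMatrix b c * Φ.adjMatrix c d * Φ.adjMatrix d a := by
  simp [walkGain, adjMatrix_of_adj, hab, hbc, hcd, hda, mul_assoc]

theorem rank_le_two_mul_card_of_cover [Fintype V] (S : Finset V)
    (h : ∀ i j, Φ.graph.Adj i j → i ∈ S ∨ j ∈ S) : Φ.rank ≤ 2 * S.card :=
  Φ.adjMatrix.rank_le_two_mul_card_of_cover S fun i j hij => h i j (Φ.adjMatrix_ne_zero_iff.1 hij)

/-- As opposite entries are mutually inverse, gain $1$ is equivalent to the vanishing of either
$2\times2$ minor between $\{a,c\}$ and $\{b,d\}$. -/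
theorem rank_le_two_of_fourCycle [Fintype V] (hab : Φ.graph.Adj a b) (hbc : Φ.graph.Adj b c)
    (hcd : Φ.graph.Adj c d) (hda : Φ.graph.Adj d a)
    (hG : ∀ e ∈ Φ.graph.edgeSet, e ∈ [s(a, b), s(b, c), s(c, d), s(d, a)])
    (hg : Φ.adjMatrix a b * Φ.adjMatrix b c * Φ.adjMatrix c d * Φ.adjMatrix d a = 1) :
    Φ.rank ≤ 2 := by
  have h1 := Φ.adjMatrix_mul_adjMatrix_symm hab
  have h2 := Φ.adjMatrix_mul_adjMatrix_symm hbc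
  have h3 := Φ.adjMatrix_mul_adjMatrix_symm hcd
  have h4 := Φ.adjMatrix_mul_adjMatrix_symm hda
  refine Matrix.rank_le_two_of_fourCycle (a := a) (b := b) (c := c) (d := d)
    (fun i j hij => Adj.mem_parts_of_fourCycle hG (Φ.adjMatrix_ne_zero_iff.1 hij))
    (Φ.adjMatrix_ne_zero_iff.2 hab) (Φ.adjMatrix_ne_zero_iff.2 hab.symm) ?_ ?_
    ⟨hab.ne, hda.ne', hbc.ne', hcd.ne⟩
  · linear_combination Φ.adjMatrix a d * Φ.adjMatrix c b * hg
      - Φ.adjMatrix a b * Φ.adjMatrix c d * h2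
      - Φ.adjMatrix a b * Φ.adjMatrix c d * Φ.adjMatrix b c * Φ.adjMatrix c b * h4
  · linear_combination -Φ.adjMatrix b a * Φ.adjMatrix d c * hg
      + Φ.adjMatrix b c * Φ.adjMatrix d a * h1
      + Φ.adjMatrix b c * Φ.adjMatrix d a * Φ.adjMatrix a b * Φ.adjMatrix b a * h3

theorem four_le_rank_of_fourCycle [Fintype V] (hab : Φ.graph.Adj a b) (hbc : Φ.graph.Adj b c)
    (hcd : Φ.graph.Adj c d) (hda : Φ.graph.Adj d a)
    (hG : ∀ e ∈ Φ.graph.edgeSet, e ∈ [s(a, b), s(b, c), s(c, d), s(d, a)])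
    (hg : Φ.adjMatrix a b * Φ.adjMatrix b c * Φ.adjMatrix c d * Φ.adjMatrix d a ≠ 1) :
    4 ≤ Φ.rank := by
  have h1 := Φ.adjMatrix_mul_adjMatrix_symm hab
  have h2 := Φ.adjMatrix_mul_adjMatrix_symm hbc
  have h3 := Φ.adjMatrix_mul_adjMatrix_symm hcd
  have h4 := Φ.adjMatrix_mul_adjMatrix_symm hda
  refine Matrix.four_le_rank_of_fourCycle (a := a) (b := b) (c := c) (d := d)
    (fun i j hij => Adj.mem_parts_of_fourCycle hG (Φ.adjMatrix_ne_zero_iff.1 hij))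
    (fun h => hg ?_) (fun h => hg ?_) ⟨hab.ne, hda.ne', hbc.ne', hcd.ne⟩
  · linear_combination Φ.adjMatrix b c * Φ.adjMatrix d a * h + h2
      + Φ.adjMatrix b c * Φ.adjMatrix c b * h4
  · linear_combination -Φ.adjMatrix a b * Φ.adjMatrix c d * h + h1
      + Φ.adjMatrix a b * Φ.adjMatrix b a * h3

variable {Φ}

theorem IsTypeBFourCycleWithIsolated.adjRank_rank_cycleDim [Fintype V]
    (h : Φ.IsTypeBFourCycleWithIsolated) :
    Φ.graph.adjRank = 2 ∧ Φ.rank = 4 ∧ Φ.graph.cycleDim = 1 := by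
  obtain ⟨v, w, hlen, ⟨hcyc, -, hgain⟩, hedges⟩ := h
  have hnodup := hcyc.support_nodup
  rw [hlen] at hgain
  match w, hlen with
  | .cons (v := b) hab (.cons (v := c) hbc (.cons (v := d) hcd (.cons hda .nil))), _ =>
  rw [coe_walkGain_four] at hgain
  norm_num at hgain
  simp only [Walk.edges_cons, Walk.edges_nil] at hedges
  simp only [Walk.support_cons, Walk.support_nil, List.tail_cons, List.nodup_cons, List.mem_cons,
    List.not_mem_nil, or_false, not_or] at hnodup
  obtain ⟨⟨-, hbd, -⟩, ⟨-, hcv⟩, -, -⟩ := hnodup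
  -- The chain $4\le r(\Phi)\le r(G)+2\theta\le 2+2$ forces equality throughout.
  have h1 := Φ.four_le_rank_of_fourCycle hab hbc hcd hda hedges hgain
  have h2 := adjRank_le_two_of_fourCycle hab hbc hcd hda hedges
  have h3 := cycleDim_le_one_of_fourCycle hab hbc hcd hbd hedges (Ne.symm hcv) hda.ne'
  have h4 := Φ.rank_le_adjRank_add
  have h5 := two_le_adjRank (G := Φ.graph) (ne_bot_iff_exists_adj.2 ⟨_, _, hab⟩)
  refine ⟨?_, ?_, ?_⟩ <;> omega

theorem isTypeBFourCycleWithIsolated_of_rank_eq [Fintype V] (hne : Φ.graph ≠ ⊥)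
    (hr : Φ.graph.adjRank = 2) (hθ : 1 ≤ Φ.graph.cycleDim)
    (hρ : (Φ.rank : ℤ) = 2 + 2 * Φ.graph.cycleDim) : Φ.IsTypeBFourCycleWithIsolated := by
  classical
  obtain ⟨u, v, huv⟩ := Φ.graph.ne_bot_iff_exists_adj.1 hne
  have hadj := adj_iff_of_adjRank_le_two hr.le huv
  -- `S` and `T` are the two sides of the complete bipartite part, with `u ∈ S` and `v ∈ T`.
  let S : Finset V := Finset.univ.filter (Φ.graph.Adj v)
  let T : Finset V := Finset.univ.filter (Φ.graph.Adj u)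
  have hS : ∀ x, x ∈ S ↔ Φ.graph.Adj v x := fun x => by simp [S]
  have hT : ∀ x, x ∈ T ↔ Φ.graph.Adj u x := fun x => by simp [T]
  have huS : u ∈ S := (hS u).2 huv.symm
  have hvT : v ∈ T := (hT v).2 huv
  have hST : Disjoint S T := Finset.disjoint_left.2 fun x hx hx' =>
    Φ.graph.irrefl ((hadj x x).2 (Or.inl ⟨(hS x).1 hx, (hT x).1 hx'⟩))
  have h1 := mul_le_cycleDim_of_completeBipartite (G := Φ.graph) S T ⟨u, huS⟩ hST
    (fun s hs t ht => (hadj s t).2 (Or.inr ⟨(hT t).1 ht, (hS s).1 hs⟩))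
    (fun x y hxy => by
      rw [hS, hT]
      have := (hadj x y).1 hxy
      tauto)
  have h2 := Φ.rank_le_two_mul_card_of_cover S fun x y hxy => by
    rw [hS, hS]
    have := (hadj x y).1 hxy
    tauto
  have h3 := Φ.rank_le_two_mul_card_of_cover T fun x y hxy => by
    rw [hT, hT]
    have := (hadj x y).1 hxy
    tauto
  -- Each side is a vertex cover, so $1+\theta\le|S|$ and $1+\theta\le|T|$. With
  -- $(|S|-1)(|T|-1)\le\theta$, a side of size at least $3$ is impossible.
  have hS2 : 2 ≤ S.card := by omega
  have hT2 : 2 ≤ T.card := by omega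
  have hS3 : S.card = 2 := by
    refine le_antisymm ?_ hS2
    by_contra hlt
    have : (1 : ℤ) * ((T.card : ℤ) - 1) < ((S.card : ℤ) - 1) * ((T.card : ℤ) - 1) :=
      mul_lt_mul_of_pos_right (by omega) (by omega)
    omega
  have hT3 : T.card = 2 := by
    refine le_antisymm ?_ hT2
    by_contra hlt
    have : ((S.card : ℤ) - 1) * 1 < ((S.card : ℤ) - 1) * ((T.card : ℤ) - 1) :=
      mul_lt_mul_of_pos_left (by omega) (by omega)
    omega
  obtain ⟨x, hxu, hSx⟩ : ∃ x, x ≠ u ∧ S = {u, x} := by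
    obtain ⟨p, q, hpq, h⟩ := Finset.card_eq_two.1 hS3
    rw [h] at huS
    rcases Finset.mem_insert.1 huS with rfl | h'
    · exact ⟨q, hpq.symm, h⟩
    · rw [Finset.mem_singleton] at h'
      subst h'
      exact ⟨p, hpq, h.trans (Finset.pair_comm _ _)⟩
  obtain ⟨y, hyv, hTy⟩ : ∃ y, y ≠ v ∧ T = {v, y} := by
    obtain ⟨p, q, hpq, h⟩ := Finset.card_eq_two.1 hT3
    rw [h] at hvT
    rcases Finset.mem_insert.1 hvT with rfl | h'
    · exact ⟨q, hpq.symm, h⟩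
    · rw [Finset.mem_singleton] at h'
      subst h'
      exact ⟨p, hpq, h.trans (Finset.pair_comm _ _)⟩
  have hvx : Φ.graph.Adj v x := (hS x).1 (by simp [hSx])
  have huy : Φ.graph.Adj u y := (hT y).1 (by simp [hTy])
  have hxy : Φ.graph.Adj x y := (hadj x y).2 (Or.inr ⟨huy, hvx⟩)
  have hedges : ∀ e ∈ Φ.graph.edgeSet, e ∈ [s(u, v), s(v, x), s(x, y), s(y, u)] := by
    intro e he
    induction e with
    | _ i j =>
    have := (hadj i j).1 he
    rw [← hS, ← hS, ← hT, ← hT, hSx, hTy] at this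
    simp only [Finset.mem_insert, Finset.mem_singleton] at this
    rcases this with ⟨rfl | rfl, rfl | rfl⟩ | ⟨rfl | rfl, rfl | rfl⟩ <;> simp
  have hcyc := Walk.isCycle_four huv hvx hxy huy.symm hxu.symm hyv.symm
  have hgain := Φ.coe_walkGain_four huv hvx hxy huy.symm
  refine ⟨u, _, ?_, ⟨hcyc, ?_, fun hg => ?_⟩, fun e he => ?_⟩
  · simp only [Walk.length_cons, Walk.length_nil]
  · simp only [Walk.length_cons, Walk.length_nil, Nat.even_iff]
  · rw [hgain] at hg
    have hg1 : Φ.adjMatrix u v * Φ.adjMatrix v x * Φ.adjMatrix x y * Φ.adjMatrix y u = 1 := by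
      rw [hg]
      simp
    have := Φ.rank_le_two_of_fourCycle huv hvx hxy huy.symm hedges hg1
    omega
  · simpa only [Walk.edges_cons, Walk.edges_nil] using hedges e he

end TGainGraph

theorem theorem4p10 {V : Type*} [Fintype V] (Φ : TGainGraph V) (hne : Φ.graph ≠ ⊥) :
    Φ.graph.adjRank ≠ 0 ∧
    1 - (Φ.graph.cycleDim : ℝ) ≤ (Φ.rank : ℝ) / (Φ.graph.adjRank : ℝ) ∧
    (Φ.rank : ℝ) / (Φ.graph.adjRank : ℝ) ≤ 1 + (Φ.graph.cycleDim : ℝ) ∧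
    ((Φ.rank : ℝ) / (Φ.graph.adjRank : ℝ) = 1 + (Φ.graph.cycleDim : ℝ) ↔
      Φ.graph.IsAcyclic ∨ Φ.IsTypeBFourCycleWithIsolated) ∧
    ((Φ.rank : ℝ) / (Φ.graph.adjRank : ℝ) = 1 - (Φ.graph.cycleDim : ℝ) ↔
      Φ.graph.IsAcyclic) := by
  have hr := SimpleGraph.two_le_adjRank hne
  have hρ := Φ.one_le_rank hne
  have hup := Φ.rank_le_adjRank_add
  have hlow := Φ.adjRank_le_rank_add
  have hθ := Φ.graph.cycleDim_nonneg
  have hrpos : (0 : ℝ) < Φ.graph.adjRank := by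
    exact_mod_cast (show 0 < Φ.graph.adjRank by omega)
  have hρpos : (0 : ℝ) < Φ.rank := by exact_mod_cast hρ
  have hquot : 0 < (Φ.rank : ℝ) / (Φ.graph.adjRank : ℝ) := div_pos hρpos hrpos
  have hacyc : Φ.graph.cycleDim = 0 → (Φ.rank : ℝ) / (Φ.graph.adjRank : ℝ) = 1 := fun h0 => by
    rw [div_eq_one_iff_eq hrpos.ne']
    exact_mod_cast (show Φ.rank = Φ.graph.adjRank by omega)
  -- Here $r(G)\ge2$ turns the additive error $2\theta$ into the multiplicative one $\theta\,r(G)$.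
  have hmul : 2 * Φ.graph.cycleDim ≤ Φ.graph.adjRank * Φ.graph.cycleDim :=
    mul_le_mul_of_nonneg_right (by exact_mod_cast hr) hθ
  have hpos : Φ.graph.cycleDim ≠ 0 → (1 : ℝ) ≤ Φ.graph.cycleDim := fun h0 => by
    exact_mod_cast (show 1 ≤ Φ.graph.cycleDim by omega)
  refine ⟨by omega, ?_, ?_, ⟨fun h => ?_, fun h => ?_⟩, ⟨fun h => ?_, fun h => ?_⟩⟩
  · by_cases h0 : Φ.graph.cycleDim = 0
    · rw [hacyc h0, h0]; simp
    · have := hpos h0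
      linarith
  · rw [div_le_iff₀ hrpos]
    have : (Φ.rank : ℤ) ≤ (1 + Φ.graph.cycleDim) * Φ.graph.adjRank := by linarith
    exact_mod_cast this
  · by_cases h0 : Φ.graph.cycleDim = 0
    · exact Or.inl (SimpleGraph.cycleDim_eq_zero_iff.1 h0)
    · refine Or.inr ?_
      rw [div_eq_iff hrpos.ne'] at h
      have h' : (Φ.rank : ℤ) = (1 + Φ.graph.cycleDim) * Φ.graph.adjRank := by exact_mod_cast h
      -- Equality and the additive bound give $\theta\,r(G)\le2\theta$, where $\theta>0$ cancels.
      have hr2 : (Φ.graph.adjRank : ℤ) ≤ 2 :=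
        le_of_mul_le_mul_right (a := Φ.graph.cycleDim) (by linarith) (by omega)
      have hr2' : Φ.graph.adjRank = 2 := by omega
      refine TGainGraph.isTypeBFourCycleWithIsolated_of_rank_eq hne hr2' (by omega) ?_
      rw [h', hr2']
      push_cast
      ring
  · rcases h with h | h
    · have h0 := SimpleGraph.cycleDim_eq_zero_iff.2 h
      rw [hacyc h0, h0]; simp
    · obtain ⟨h1, h2, h3⟩ := h.adjRank_rank_cycleDim
      rw [h1, h2, h3]; norm_num
  -- If $\theta\ge1$, equality would make the positive quotient equal to $1-\theta\le0$.
  · by_contra h0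
    have := hpos (mt SimpleGraph.cycleDim_eq_zero_iff.1 h0)
    linarith
  · have h0 := SimpleGraph.cycleDim_eq_zero_iff.2 h
    rw [hacyc h0, h0]; simp
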